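/- **Conventions.** A subset $P$ of a group $G$ is *thick* if $P=P^{-1}$ and there is a natural number $n$ such that for all $g_1,\dots,g_n\in G$ (not necessarily distinct) there are $i<j$ with $g_i^{-1}g_j\in P$. For $P\subseteq G$ let $\mathcal G=(G,\cdot,P)$ be the first-order structure with the group operation and a unary predicate for $P$. A *sufficiently saturated extension* of $\mathcal G$ is an elementary extension $\mathcal G^*$ that is $\kappa$-saturated and strongly $\kappa$-homogeneous for some cardinal $\kappa>2^{\aleph_0}$. For such $\mathcal G^*$ and $\kappa$, $\mathcal G^{*0}_\emptyset$ is the intersection of all $\emptyset$-definable subgroups of finite index in $\mathcal G^*$, and $\mathcal G^{*00}_\emptyset$ is the smallest subgroup of $\mathcal G^*$ that is type-definable over $\emptyset$ (an intersection of $\emptyset$-definable sets) and has bounded index (index less than $\kappa$). **Corollary 4.10.** Let $G$ be an infinite finitely generated group. (1) Suppose that $G$ has a finite-index subgroup $H$ whose abelianization $H/[H,H]$ is infinite. Then there is a thick subset $P\subseteq G$ such that for every sufficiently saturated extension $\mathcal G^*$ of $\mathcal G=(G,\cdot,P)$ the group $\mathcal G^{*00}_\emptyset$ exists and is strictly smaller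 than $\mathcal G^{*0}_\emptyset$, that is, $\mathcal G^{*00}_\emptyset\subsetneq\mathcal G^{*0}_\emptyset$. (2) If $G$ is virtually solvable (it has a solvable subgroup of finite index), then $G$ has a finite-index subgroup with infinite abelianization. Hence the conclusion of (1) holds for $G$. -/

import Mathlib

universe u v w x

namespace GroupComponents

open FirstOrder FirstOrder.Language Cardinal

/-! ### Thick subsets and virtually solvable groups -/

/-- `P` is `n`-thick: it is symmetric and every sequence `g₁, …, gₙ` of (not necessarily distinct)
elements has `i < j` with `gᵢ⁻¹ gⱼ ∈ P`. -/
def IsNThick {G : Type u} [Group G] (n : ℕ) (P : Set G) : Prop :=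
  (∀ g : G, g⁻¹ ∈ P ↔ g ∈ P) ∧
    ∀ g : Fin n → G, ∃ i j : Fin n, i < j ∧ (g i)⁻¹ * g j ∈ P

/-- `P` is thick: it is `n`-thick for some natural number `n`. -/
def IsThick {G : Type u} [Group G] (P : Set G) : Prop :=
  ∃ n : ℕ, IsNThick n P

/-- `G` has a solvable subgroup of finite index. -/
def IsVirtuallySolvable (G : Type u) [Group G] : Prop :=
  ∃ K : Subgroup G, K.FiniteIndex ∧ Group.IsSolvable K

/-- `G` has a finite-index subgroup whose abelianization is infinite. -/
def HasFiniteIndexSubgroupWithInfiniteAbelianization (G : Type u) [Group G] : Prop :=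
  ∃ H : Subgroup G, H.FiniteIndex ∧ Infinite (Abelianization H)

/-! ### Saturated and strongly homogeneous structures -/

section Saturation

variable (L : FirstOrder.Language.{u, v}) (M : Type w) [L.Structure M]

/-- `M` is `κ`-saturated: for every parameter set `A` of cardinality less than `κ`, every set of
formulas over `A` in one variable that is finitely satisfiable in `M` is realized in `M`. -/
def IsSaturated (κ : Cardinal.{w}) : Prop :=
  ∀ A : Set M, #A < κ → ∀ p : Set (L[[A]].Formula (Fin 1)),
    (∀ s : Finset (L[[A]].Formula (Fin 1)), (s : Set (L[[A]].Formula (Fin 1))) ⊆ p →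
      ∃ v : Fin 1 → M, ∀ φ ∈ s, φ.Realize v) →
    ∃ v : Fin 1 → M, ∀ φ ∈ p, φ.Realize v

/-- `M` is strongly `κ`-homogeneous: every partial elementary map of `M` whose domain has
cardinality less than `κ` extends to an automorphism of `M`. -/
def IsStronglyHomogeneous (κ : Cardinal.{w}) : Prop :=
  ∀ A : Set M, #A < κ → ∀ f : A → M,
    (∀ (n : ℕ) (φ : L.Formula (Fin n)) (a : Fin n → A),
      φ.Realize (fun i => (a i : M)) ↔ φ.Realize (fun i => f (a i))) →
    ∃ σ : M ≃[L] M, ∀ a : A, σ a = f a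

end Saturation

/-! ### Connected components -/

section Components

variable (L : FirstOrder.Language.{u, v}) {M : Type w} [L.Structure M] [Group M]

/-- A subgroup is type-definable over `A` if it is an intersection of sets definable over `A`. -/
def IsTypeDefinable (A : Set M) (H : Subgroup M) : Prop :=
  ∃ 𝒟 : Set (Set M), (∀ D ∈ 𝒟, A.Definable₁ L D) ∧ (H : Set M) = ⋂₀ 𝒟

/-- The connected component over `A`: the intersection of all subgroups that are definable over `A`
and have finite index. -/
def connectedComponent (A : Set M) : Subgroup M :=
  sInf {H : Subgroup M | A.Definable₁ L (H : Set M) ∧ H.FiniteIndex}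

/-- `N` is the type-connected component over `A` (with respect to the saturation cardinal `κ`): it
is the smallest subgroup that is type-definable over `A` and has bounded index, that is, index less
than `κ`. -/
def IsTypeConnectedComponent (κ : Cardinal.{w}) (A : Set M) (N : Subgroup M) : Prop :=
  IsLeast {H : Subgroup M | IsTypeDefinable L A H ∧ #(M ⧸ H) < κ} N

end Components

/-! ### The structure `(G, ·, P)` -/

/-- The function symbols: one binary symbol for the group operation. -/
inductive GroupPredFunc : ℕ → Type
  | mul : GroupPredFunc 2

/-- The relation symbols: one unary predicate. -/
inductive GroupPredRel : ℕ → Type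
  | pred : GroupPredRel 1

/-- The language `{·, P}` of a group with a unary predicate. -/
def groupPred : FirstOrder.Language.{0, 0} where
  Functions := GroupPredFunc
  Relations := GroupPredRel

/-- The structure `(G, ·, P)`. -/
@[reducible]
def groupPredStructure {G : Type u} [Group G] (P : Set G) : groupPred.Structure G where
  funMap := fun f => match f with
    | GroupPredFunc.mul => fun y => y 0 * y 1
  RelMap := fun r => match r with
    | GroupPredRel.pred => fun y => y 0 ∈ P

/-- In every sufficiently saturated elementary extension `M` of `(G, ·, P)`, the type-connected
component over the empty set exists and is strictly smaller than the connected component over the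
empty set. Sufficiently saturated means `κ`-saturated and strongly `κ`-homogeneous with `2 ^ ℵ₀ < κ`
(the language is countable and there are no parameters). The interpretation of `·` in an elementary
extension of a group is again a group operation, and it determines the group structure on `M`; the
hypothesis on `funMap` says that the `Group` instance on `M` is that one. -/
def SeparatesComponents {G : Type u} [Group G] (P : Set G) : Prop :=
  letI : groupPred.Structure G := groupPredStructure P
  ∀ (M : Type x) [groupPred.Structure M] [Group M],
    (∀ a b : M, Structure.funMap (L := groupPred) GroupPredFunc.mul ![a, b] = a * b) →
    Nonempty (G ↪ₑ[groupPred] M) →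
    ∀ κ : Cardinal.{x}, (2 : Cardinal.{x}) ^ (ℵ₀ : Cardinal.{x}) < κ →
      IsSaturated groupPred M κ → IsStronglyHomogeneous groupPred M κ →
        ∃ N : Subgroup M, IsTypeConnectedComponent groupPred κ ∅ N ∧
          N < connectedComponent groupPred (∅ : Set M)

end GroupComponents

/-! Finite generation passes to `H`, so an infinite abelianization yields a surjection of `H` onto
`ℤ`; sending `1` to an element of infinite order in `ℝ / ℤ` gives `θ`, additive on `H`. The thick
set is the Bohr set `P` of those `g` in `H` with `‖θ g‖ < 1/4`.

Below `1/4` doubling in the circle doubles the norm exactly, so the Bohr sets of radius `1/4 / 2 ^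
k` are definable from `P` by squaring (`iteratedHalf_bohrSet`). Finitely many translates of each
cover the group, and each refines its predecessor. Both facts are first-order and transfer to `M`,
where the intersection `T` of the definable sets is a type-definable subgroup of index at most `2 ^
ℵ₀`. Hence the type-connected component lies in `T`, and so in the predicate.

If the connected component did too, saturation would put a definable finite-index subgroup inside
the predicate, and its pullback would be a finite-index subgroup of `G` inside `P`. That is
impossible (`not_subset_bohrSet`): doubling drives every nonzero point out of the `1/4`-ball.

For virtually solvable groups: if all finite-index subgroups had finite abelianization, every
derived subgroup would have finite index, contradicting solvability of an infinite group. -/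

namespace GroupComponents

open FirstOrder FirstOrder.Language Cardinal

/-! ### Covering, refinement and bounded index -/

section Index

variable {M : Type w} [Group M]

/-- Finitely many right translates of `D` cover the group. -/
def FinitelyCovers (D : Set M) : Prop :=
  ∃ F : Set M, F.Finite ∧ ∀ x, ∃ a ∈ F, x * a ∈ D

/-- `D'` is a refinement of `D` if `D' * D'⁻¹ ⊆ D`. -/
def Refines (D' D : Set M) : Prop :=
  ∀ y z, y ∈ D' → z * y ∈ D' → z ∈ D

/-- A coset is coded by recording, for each `D`, which of the finitely many translating elements
brings the inverse of its representative into `D`. If `p` and `q` share their codes, refinement puts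
`p⁻¹ q` in every `D`, hence in `H`. There are at most `ℵ₀ ^ ℵ₀` codes. -/
theorem mk_quotient_le_of_finitelyCovers {𝓕 : Set (Set M)} (hcount : 𝓕.Countable)
    (hcov : ∀ D ∈ 𝓕, FinitelyCovers D) (href : ∀ D ∈ 𝓕, ∃ D' ∈ 𝓕, Refines D' D)
    {H : Subgroup M} (hH : ⋂₀ 𝓕 ⊆ H) : #(M ⧸ H) ≤ (2 : Cardinal.{w}) ^ (ℵ₀ : Cardinal.{w}) := by
  choose! F hF t htF ht using hcov
  have henc : ∀ D ∈ 𝓕, ∃ e : M → ℕ, Set.InjOn e (F D) := fun D hD =>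
    Set.countable_iff_exists_injOn.1 (hF D hD).countable
  choose! e he using henc
  let c : M ⧸ H → 𝓕 → ℕ := fun q D => e D (t D (q.out)⁻¹)
  have hc : Function.Injective c := by
    intro p q hpq
    rw [← QuotientGroup.out_eq' p, ← QuotientGroup.out_eq' q, QuotientGroup.eq]
    refine hH fun D hD => ?_
    obtain ⟨D', hD', hr⟩ := href D hD
    have h1 : t D' (p.out)⁻¹ = t D' (q.out)⁻¹ :=
      he D' hD' (htF D' hD' _) (htF D' hD' _) (congrFun hpq ⟨D', hD'⟩)
    refine hr _ _ (ht D' hD' (q.out)⁻¹) ?_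
    rw [mul_assoc, mul_inv_cancel_left, ← h1]
    exact ht D' hD' _
  have h𝓕 : #𝓕 ≤ ℵ₀ := mk_le_aleph0_iff.2 hcount.to_subtype
  calc #(M ⧸ H) ≤ #(𝓕 → ℕ) := mk_le_of_injective hc
    _ = ℵ₀ ^ #𝓕 := by simp
    _ ≤ ℵ₀ ^ (ℵ₀ : Cardinal.{w}) := power_le_power_left aleph0_ne_zero h𝓕
    _ = 2 ^ (ℵ₀ : Cardinal.{w}) := by rw [aleph0_power_aleph0, two_power_aleph0]

end Index

/-! ### Definable sets in a group -/

section Definable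

variable {L : FirstOrder.Language.{u, v}} {M : Type w} [L.Structure M] {A : Set M}

theorem definable_preimage {α : Type*} {f : (α → M) → M} (hf : A.DefinableFun L f)
    {D : Set M} (hD : A.Definable₁ L D) : A.Definable L {v | f v ∈ D} :=
  Set.Definable.preimage_map (F := fun v (_ : Fin 1) => f v) (fun _ => hf) hD

theorem definable₁_inter {D E : Set M} (hD : A.Definable₁ L D) (hE : A.Definable₁ L E) :
    A.Definable₁ L (D ∩ E) :=
  Set.Definable.inter hD hE

theorem definable₁_compl {D : Set M} (hD : A.Definable₁ L D) : A.Definable₁ L Dᶜ :=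
  Set.Definable.compl hD

theorem countable_definable₁ [Countable L.Symbols] :
    {D : Set M | (∅ : Set M).Definable₁ L D}.Countable := by
  let f : L.Formula (Fin 1) → Set M := fun φ => {x | φ.Realize fun _ => x}
  refine (Set.countable_range f).mono ?_
  intro D hD
  obtain ⟨φ, hφ⟩ := Set.empty_definable_iff.1 hD
  refine ⟨φ, ?_⟩
  ext x
  exact (Set.ext_iff.1 hφ fun _ => x).symm

variable [Group M]

theorem definableFun_mul (hmul : (∅ : Set M).DefinableFun L fun v : Fin 2 → M => v 0 * v 1)
    {α : Type*} {f g : (α → M) → M} (hf : A.DefinableFun L f) (hg : A.DefinableFun L g) :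
    A.DefinableFun L fun v => f v * g v := by
  have h : A.DefinableMap L (fun v => ![f v, g v]) := by
    intro i
    fin_cases i
    · exact hf
    · exact hg
  exact Set.DefinableFun.comp h (Set.DefinableFun.of_empty hmul)

theorem definable₁_mul_right (hmul : (∅ : Set M).DefinableFun L fun v : Fin 2 → M => v 0 * v 1)
    {D : Set M} (hD : A.Definable₁ L D) {a : M} (ha : a ∈ A) :
    A.Definable₁ L {x | x * a ∈ D} :=
  definable_preimage (definableFun_mul hmul (Set.DefinableFun.proj L)
    (L.definableFun_const _ ha)) hD

theorem definable₁_mul_left (hmul : (∅ : Set M).DefinableFun L fun v : Fin 2 → M => v 0 * v 1)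
    {D : Set M} (hD : A.Definable₁ L D) {a : M} (ha : a ∈ A) :
    A.Definable₁ L {x | a * x ∈ D} :=
  definable_preimage (definableFun_mul hmul (L.definableFun_const _ ha)
    (Set.DefinableFun.proj L)) hD

theorem definable₁_exists_mul (hmul : (∅ : Set M).DefinableFun L fun v : Fin 2 → M => v 0 * v 1)
    {D : Set M} (hD : A.Definable₁ L D) :
    A.Definable₁ L {z | ∃ y ∈ D, z * y ∈ D} := by
  have h : A.Definable L {v : Fin 1 ⊕ Fin 1 → M | v (.inr 0) ∈ D ∧ v (.inl 0) * v (.inr 0) ∈ D} :=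
    (definable_preimage (Set.DefinableFun.proj L) hD).inter
      (definable_preimage (definableFun_mul hmul (Set.DefinableFun.proj L)
        (Set.DefinableFun.proj L)) hD)
  refine (congrArg (A.Definable L) ?_).mp h.exists_of_finite
  ext v
  constructor
  · rintro ⟨u, h1, h2⟩
    exact ⟨u 0, h1, h2⟩
  · rintro ⟨y, h1, h2⟩
    exact ⟨fun _ => y, h1, h2⟩

end Definable

/-! ### Saturation for families of definable sets -/

section Saturation

variable {L : FirstOrder.Language.{u, v}} {M : Type w} [L.Structure M] {κ : Cardinal.{w}}

theorem IsSaturated.exists_forall_mem (hsat : IsSaturated L M κ) {A : Set M} (hA : #A < κ)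
    {ι : Type*} {E : ι → Set M} (hdef : ∀ i, A.Definable₁ L (E i))
    (hfin : ∀ s : Finset ι, ∃ x, ∀ i ∈ s, x ∈ E i) : ∃ x, ∀ i, x ∈ E i := by
  classical
  choose φ hφ using hdef
  have hφ' : ∀ i v, (φ i).Realize v ↔ v 0 ∈ E i := fun i v => (Set.ext_iff.1 (hφ i) v).symm
  obtain ⟨v, hv⟩ := hsat A hA (φ '' Set.univ) (by
    intro s hs
    obtain ⟨t, -, rfl⟩ := Finset.subset_set_image_iff.1 hs
    obtain ⟨x, hx⟩ := hfin t
    refine ⟨fun _ => x, fun ψ hψ => ?_⟩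
    obtain ⟨i, hi, rfl⟩ := Finset.mem_image.1 hψ
    exact (hφ' i _).2 (hx i hi))
  exact ⟨v 0, fun i => (hφ' i v).1 (hv _ ⟨i, trivial, rfl⟩)⟩

theorem IsSaturated.exists_forall_mem_of_directed (hsat : IsSaturated L M κ) {A : Set M}
    (hA : #A < κ) {ι : Type*} [Nonempty ι] {E : ι → Set M} (hdef : ∀ i, A.Definable₁ L (E i))
    (hdir : Directed (· ⊇ ·) E) (hne : ∀ i, (E i).Nonempty) : ∃ x, ∀ i, x ∈ E i := by
  refine hsat.exists_forall_mem hA hdef fun s => ?_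
  obtain ⟨j, hj⟩ := hdir.finset_le s
  obtain ⟨x, hx⟩ := hne j
  exact ⟨x, fun i hi => hj i hi hx⟩

end Saturation

/-! ### Existence of the type-connected component -/

section TypeConnectedComponent

variable (L : FirstOrder.Language.{u, v}) {M : Type w} [L.Structure M] [Group M]
  {κ : Cardinal.{w}}

/-- The sets that are definable over `∅` and contain `H`. -/
def definableSupersets (H : Subgroup M) : Set (Set M) :=
  {D | (∅ : Set M).Definable₁ L D ∧ (H : Set M) ⊆ D}

variable {L}

theorem IsTypeDefinable.sInter_subset {H : Subgroup M} (hH : IsTypeDefinable L ∅ H) :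
    ⋂₀ definableSupersets L H ⊆ H := by
  obtain ⟨𝒟, hdef, hH⟩ := hH
  intro x hx
  rw [hH]
  exact fun D hD => hx D ⟨hdef D hD, hH ▸ Set.sInter_subset_of_mem hD⟩

instance (H : Subgroup M) : Nonempty (definableSupersets L H) :=
  ⟨⟨Set.univ, Set.definable_univ, Set.subset_univ _⟩⟩

theorem definableSupersets_directed {H : Subgroup M} :
    Directed (· ⊇ ·) (fun D : definableSupersets L H => (D : Set M)) := fun D E =>
  ⟨⟨D ∩ E, definable₁_inter D.2.1 E.2.1, Set.subset_inter D.2.2 E.2.2⟩,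
    Set.inter_subset_left, Set.inter_subset_right⟩

/-- Compactness applied twice. If no `D'` works, saturation gives one `z` outside `D` that is a
quotient of two elements of every `D'`, and then, over the parameter `z`, one `y` witnessing this
for all `D'` at once. So `y` and `z * y` lie in `H`, forcing `z` into `H ⊆ D`. -/
theorem exists_refines_of_isTypeDefinable (hsat : IsSaturated L M κ) (hκ : ℵ₀ < κ)
    (hmul : (∅ : Set M).DefinableFun L fun v : Fin 2 → M => v 0 * v 1)
    {H : Subgroup M} (hH : IsTypeDefinable L ∅ H) {D : Set M} (hD : D ∈ definableSupersets L H) :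
    ∃ D' ∈ definableSupersets L H, Refines D' D := by
  by_contra! hcon
  have hempty : #(∅ : Set M) < κ := by simpa using aleph0_pos.trans hκ
  obtain ⟨z, hz⟩ := hsat.exists_forall_mem_of_directed hempty
    (E := fun D' : definableSupersets L H => {z | ∃ y ∈ (D' : Set M), z * y ∈ (D' : Set M)} ∩ Dᶜ)
    (fun D' => definable₁_inter (definable₁_exists_mul hmul D'.2.1) (definable₁_compl hD.1))
    (definableSupersets_directed.mono_comp (· ⊇ ·)
      (g := fun S : Set M => {z | ∃ y ∈ S, z * y ∈ S} ∩ Dᶜ)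
      fun S T hST => Set.inter_subset_inter_left _ fun z ⟨y, h1, h2⟩ => ⟨y, hST h1, hST h2⟩)
    (fun D' => by
      have h := hcon D' D'.2
      simp only [Refines, not_forall] at h
      obtain ⟨y, z, h1, h2, h3⟩ := h
      exact ⟨z, ⟨y, h1, h2⟩, h3⟩)
  obtain ⟨y, hy⟩ := hsat.exists_forall_mem_of_directed (A := {z})
    (by simpa using one_lt_aleph0.trans hκ)
    (E := fun D' : definableSupersets L H => (D' : Set M) ∩ {y | z * y ∈ (D' : Set M)})
    (fun D' => definable₁_inter (Set.Definable.mono D'.2.1 (Set.empty_subset _))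
      (definable₁_mul_left hmul (Set.Definable.mono D'.2.1 (Set.empty_subset _)) rfl))
    (definableSupersets_directed.mono_comp (· ⊇ ·)
      (g := fun S : Set M => S ∩ {y | z * y ∈ S})
      fun S T hST => Set.inter_subset_inter hST fun y hy => hST hy)
    (fun D' => by
      obtain ⟨y, h1, h2⟩ := (hz D').1
      exact ⟨y, h1, h2⟩)
  have h1 : y ∈ H := hH.sInter_subset fun D' hD' => (hy ⟨D', hD'⟩).1
  have h2 : z * y ∈ H := hH.sInter_subset fun D' hD' => (hy ⟨D', hD'⟩).2
  exact (hz ⟨D, hD⟩).2 (hD.2 ((H.mul_mem_cancel_right h1).1 h2))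

/-- Otherwise saturation over a set of fewer than `κ` coset representatives gives `x` with `x * a ∉
D` for every representative `a`. The representative of the coset of `x⁻¹` contradicts this. -/
theorem finitelyCovers_of_mk_quotient_lt (hsat : IsSaturated L M κ)
    (hmul : (∅ : Set M).DefinableFun L fun v : Fin 2 → M => v 0 * v 1)
    {H : Subgroup M} (hH : #(M ⧸ H) < κ) {D : Set M} (hD : D ∈ definableSupersets L H) :
    FinitelyCovers D := by
  by_contra hcon
  let A : Set M := Set.range (Quotient.out : M ⧸ H → M)
  have hA : #A < κ := mk_range_le.trans_lt hH
  obtain ⟨x, hx⟩ := hsat.exists_forall_mem hA (E := fun a : A => {x | x * a ∈ D}ᶜ)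
    (fun a => definable₁_compl
      (definable₁_mul_right hmul (Set.Definable.mono hD.1 (Set.empty_subset _)) a.2))
    (fun s => by
      by_contra! h
      refine hcon ⟨Subtype.val '' (s : Set A), s.finite_toSet.image _, fun x => ?_⟩
      obtain ⟨a, ha, hxa⟩ := h x
      exact ⟨a, ⟨a, ha, rfl⟩, by simpa using hxa⟩)
  refine hx ⟨_, ⟨((x⁻¹ : M) : M ⧸ H), rfl⟩⟩ (hD.2 ?_)
  have := QuotientGroup.eq.1 (QuotientGroup.out_eq' ((x⁻¹ : M) : M ⧸ H)).symm
  simpa using this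

/-- The candidate is the intersection of all competitors. Its index stays bounded however many there
are, because only countably many sets are definable over `∅`. -/
theorem exists_isTypeConnectedComponent [Countable L.Symbols] (hsat : IsSaturated L M κ)
    (hκ : (2 : Cardinal.{w}) ^ (ℵ₀ : Cardinal.{w}) < κ)
    (hmul : (∅ : Set M).DefinableFun L fun v : Fin 2 → M => v 0 * v 1) :
    ∃ N : Subgroup M, IsTypeConnectedComponent L κ ∅ N := by
  have hκ' : ℵ₀ < κ := (cantor _).trans hκ
  let S : Set (Subgroup M) := {H | IsTypeDefinable L ∅ H ∧ #(M ⧸ H) < κ}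
  let 𝓕 : Set (Set M) := ⋃ H ∈ S, definableSupersets L H
  have hmem : ∀ {D}, D ∈ 𝓕 ↔ ∃ H ∈ S, D ∈ definableSupersets L H := by simp [𝓕]
  have hdef : ∀ D ∈ 𝓕, (∅ : Set M).Definable₁ L D := fun D hD => by
    obtain ⟨H, -, h⟩ := hmem.1 hD
    exact h.1
  have hN : ((sInf S : Subgroup M) : Set M) = ⋂₀ 𝓕 := by
    ext x
    simp only [Subgroup.coe_sInf, Set.mem_iInter, Set.mem_sInter]
    constructor
    · intro hx D hD
      obtain ⟨H, hH, h⟩ := hmem.1 hD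
      exact h.2 (hx H hH)
    · exact fun hx H hH => hH.1.sInter_subset fun D hD => hx D (hmem.2 ⟨H, hH, hD⟩)
  refine ⟨sInf S, ⟨⟨𝓕, hdef, hN⟩, ?_⟩, fun H hH => sInf_le hH⟩
  refine (mk_quotient_le_of_finitelyCovers (𝓕 := 𝓕) (countable_definable₁.mono hdef)
    (fun D hD => ?_) (fun D hD => ?_) hN.ge).trans_lt hκ
  · obtain ⟨H, hH, h⟩ := hmem.1 hD
    exact finitelyCovers_of_mk_quotient_lt hsat hmul hH.2 h
  · obtain ⟨H, hH, h⟩ := hmem.1 hD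
    obtain ⟨D', hD', hr⟩ := exists_refines_of_isTypeDefinable hsat hκ' hmul hH.1 h
    exact ⟨D', hmem.2 ⟨H, hH, hD'⟩, hr⟩

/-- Every finite-index subgroup defined over `∅` is type-definable of bounded index. -/
theorem IsTypeConnectedComponent.le_connectedComponent (hκ : ℵ₀ < κ) {N : Subgroup M}
    (hN : IsTypeConnectedComponent L κ ∅ N) : N ≤ connectedComponent L (∅ : Set M) := by
  refine le_sInf fun H hH => hN.2 ⟨⟨{(H : Set M)}, by simpa using hH.1, by simp⟩, ?_⟩
  have := hH.2
  exact (lt_aleph0_of_finite _).trans hκ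

/-- A definable set containing the connected component contains a definable subgroup of finite
index. -/
theorem exists_finiteIndex_subset (hsat : IsSaturated L M κ) (hκ : 0 < κ) {D : Set M}
    (hD : (∅ : Set M).Definable₁ L D) (h : (connectedComponent L (∅ : Set M) : Set M) ⊆ D) :
    ∃ K : Subgroup M, K.FiniteIndex ∧ (K : Set M) ⊆ D := by
  by_contra! hcon
  let ι := {H : Subgroup M // (∅ : Set M).Definable₁ L (H : Set M) ∧ H.FiniteIndex}
  have : Nonempty ι := ⟨⟨⊤, Set.definable_univ, inferInstance⟩⟩
  obtain ⟨x, hx⟩ := hsat.exists_forall_mem_of_directed (by simpa using hκ)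
    (E := fun H : ι => ((H : Subgroup M) : Set M) ∩ Dᶜ)
    (fun H => definable₁_inter H.2.1 (definable₁_compl hD))
    (fun H K => by
      have := H.2.2
      have := K.2.2
      exact ⟨⟨H ⊓ K, definable₁_inter H.2.1 K.2.1, inferInstance⟩,
        Set.inter_subset_inter_left _ inf_le_left, Set.inter_subset_inter_left _ inf_le_right⟩)
    (fun H => Set.not_subset.1 (hcon H H.2.2))
  exact (hx (Classical.arbitrary ι)).2 (h (Subgroup.mem_sInf.2 fun H hH => (hx ⟨H, hH⟩).1))

end TypeConnectedComponent

/-! ### Doubling in the circle -/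

section Circle

theorem norm_add_self_of_norm_lt {x : UnitAddCircle} (hx : ‖x‖ < 1 / 4) : ‖x + x‖ = 2 * ‖x‖ := by
  obtain ⟨r, rfl⟩ := QuotientAddGroup.mk_surjective x
  -- The representative in `[-1/2, 1/2]` computes the norm; as the norm is below `1/4`, its double
  -- is still in that range.
  have hs : ((r - round r : ℝ) : UnitAddCircle) = (r : UnitAddCircle) := by
    have : ((round r : ℝ) : UnitAddCircle) = 0 :=
      (AddCircle.coe_eq_zero_iff 1).2 ⟨round r, by simp⟩
    rw [AddCircle.coe_sub, this, sub_zero]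
  change ‖(r : UnitAddCircle)‖ < 1 / 4 at hx
  change ‖(r : UnitAddCircle) + r‖ = 2 * ‖(r : UnitAddCircle)‖
  rw [← hs] at hx ⊢
  have hle : |r - round r| ≤ 1 / 2 := abs_sub_round r
  generalize r - round r = s at *
  have h1 : ‖(s : UnitAddCircle)‖ = |s| :=
    (AddCircle.norm_coe_eq_abs_iff 1 one_ne_zero).2 (by simpa using hle)
  rw [h1] at hx ⊢
  rw [← AddCircle.coe_add, (AddCircle.norm_coe_eq_abs_iff 1 one_ne_zero).2]
  · rw [← two_mul, abs_mul, abs_two]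
  · rw [← two_mul, abs_mul, abs_two, abs_one]
    linarith

theorem eq_zero_of_forall_norm_two_pow_nsmul_lt {x : UnitAddCircle}
    (hx : ∀ k : ℕ, ‖(2 ^ k) • x‖ < 1 / 4) : x = 0 := by
  have h : ∀ k : ℕ, ‖(2 ^ k) • x‖ = 2 ^ k * ‖x‖ := by
    intro k
    induction k with
    | zero => simp
    | succ k ih =>
      rw [pow_succ, mul_nsmul, two_nsmul, ← nsmul_add, ← two_nsmul, nsmul_left_comm, two_nsmul,
        norm_add_self_of_norm_lt (hx k), ih]
      ring
  by_contra hne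
  have hpos : 0 < ‖x‖ := norm_pos_iff.2 hne
  obtain ⟨k, hk⟩ := pow_unbounded_of_one_lt (1 / 4 / ‖x‖) one_lt_two
  rw [div_lt_iff₀ hpos, ← h k] at hk
  exact lt_asymm hk (hx k)

theorem exists_unitAddCircle_nsmul_ne_zero : ∃ x : UnitAddCircle, ∀ n : ℤ, n ≠ 0 → n • x ≠ 0 := by
  refine ⟨(√2 : ℝ), fun n hn h => ?_⟩
  rw [← AddCircle.coe_zsmul, AddCircle.coe_eq_zero_iff] at h
  obtain ⟨m, hm⟩ := h
  refine irrational_sqrt_two ⟨m / n, ?_⟩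
  have : (n : ℝ) ≠ 0 := by exact_mod_cast hn
  push_cast
  rw [div_eq_iff this]
  simpa [mul_comm] using hm

end Circle

/-! ### Bohr sets: thickness and finite-index subgroups -/

section BohrSet

variable {G : Type u} [Group G]

/-- The elements of `H` that `θ` maps to the `ε`-neighbourhood of `0` in `ℝ / ℤ`. -/
def bohrSet (H : Subgroup G) (θ : G → UnitAddCircle) (ε : ℝ) : Set G :=
  {g | g ∈ H ∧ ‖θ g‖ < ε}

variable {H : Subgroup G} {θ : G → UnitAddCircle} {ε : ℝ}

theorem map_pow_of_map_mul (hθ : ∀ a ∈ H, ∀ b ∈ H, θ (a * b) = θ a + θ b) {a : G} (ha : a ∈ H)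
    (n : ℕ) : θ (a ^ n) = n • θ a := by
  induction n with
  | zero => simpa using hθ 1 H.one_mem 1 H.one_mem
  | succ n ih => rw [pow_succ, hθ _ (H.pow_mem ha n) _ ha, ih, succ_nsmul]

theorem map_inv_mul_of_map_mul (hθ : ∀ a ∈ H, ∀ b ∈ H, θ (a * b) = θ a + θ b) {a b : G}
    (ha : a ∈ H) (hb : b ∈ H) : θ (a⁻¹ * b) = θ b - θ a := by
  rw [eq_sub_iff_add_eq', ← hθ a ha _ (H.mul_mem (H.inv_mem ha) hb), mul_inv_cancel_left]

theorem inv_mem_bohrSet (hθ : ∀ a ∈ H, ∀ b ∈ H, θ (a * b) = θ a + θ b) (g : G) :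
    g⁻¹ ∈ bohrSet H θ ε ↔ g ∈ bohrSet H θ ε := by
  have h0 : θ 1 = 0 := by simpa using hθ 1 H.one_mem 1 H.one_mem
  refine (and_congr_left' H.inv_mem_iff).trans (and_congr_right fun hg => ?_)
  have := map_inv_mul_of_map_mul hθ hg H.one_mem
  rw [mul_one, h0, zero_sub] at this
  rw [this, norm_neg]

theorem refines_bohrSet (hθ : ∀ a ∈ H, ∀ b ∈ H, θ (a * b) = θ a + θ b) :
    Refines (bohrSet H θ (ε / 2)) (bohrSet H θ ε) := by
  rintro y z ⟨hy, hy'⟩ ⟨hzy, hzy'⟩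
  have hz : z ∈ H := (H.mul_mem_cancel_right hy).1 hzy
  refine ⟨hz, ?_⟩
  have : θ z = θ (z * y) - θ y := by rw [hθ z hz y hy, add_sub_cancel_right]
  rw [this]
  linarith [norm_sub_le (θ (z * y)) (θ y)]

/-- A finite colouring whose colour classes have all their differences in the Bohr set. -/
theorem exists_finite_colouring_bohrSet [H.FiniteIndex]
    (hθ : ∀ a ∈ H, ∀ b ∈ H, θ (a * b) = θ a + θ b) (hε : 0 < ε) :
    ∃ (X : Type u) (_ : Finite X) (c : G → X), ∀ g g', c g = c g' → g⁻¹ * g' ∈ bohrSet H θ ε := by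
  obtain ⟨t, -, htf, ht⟩ :=
    finite_cover_balls_of_compact (isCompact_univ (X := UnitAddCircle)) (half_pos hε)
  have hnear : ∀ x : UnitAddCircle, ∃ y : t, dist x y < ε / 2 := fun x => by
    obtain ⟨y, hy, hxy⟩ := Set.mem_iUnion₂.1 (ht (Set.mem_univ x))
    exact ⟨⟨y, hy⟩, hxy⟩
  choose near hnear using hnear
  let o : G → G := fun g => (g : G ⧸ H).out
  have ho : ∀ g, (o g)⁻¹ * g ∈ H := fun g => QuotientGroup.eq.1 (QuotientGroup.out_eq' _)
  have := htf.to_subtype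
  -- Since `θ` is additive only on `H`, each `g` is first moved into `H` by its coset
  -- representative; the colour is the coset together with a nearby point of a finite `ε / 2`-net.
  refine ⟨(G ⧸ H) × t, inferInstance, fun g => (g, near (θ ((o g)⁻¹ * g))), fun g g' h => ?_⟩
  obtain ⟨h1, h2⟩ := Prod.ext_iff.1 h
  have ho' : o g = o g' := congrArg Quotient.out h1
  refine ⟨QuotientGroup.eq.1 h1, ?_⟩
  have key : g⁻¹ * g' = ((o g)⁻¹ * g)⁻¹ * ((o g')⁻¹ * g') := by rw [ho']; group
  rw [key, map_inv_mul_of_map_mul hθ (ho g) (ho g'), ← dist_eq_norm]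
  have h3 := hnear (θ ((o g)⁻¹ * g))
  have h4 := hnear (θ ((o g')⁻¹ * g'))
  dsimp only at h2
  rw [h2] at h3
  linarith [dist_triangle_right (θ ((o g')⁻¹ * g')) (θ ((o g)⁻¹ * g))
    (near (θ ((o g')⁻¹ * g')))]

theorem finitelyCovers_bohrSet [H.FiniteIndex]
    (hθ : ∀ a ∈ H, ∀ b ∈ H, θ (a * b) = θ a + θ b) (hε : 0 < ε) :
    FinitelyCovers (bohrSet H θ ε) := by
  obtain ⟨X, _, c, hc⟩ := exists_finite_colouring_bohrSet hθ hε
  -- One representative per colour; the one with the colour of `x⁻¹` translates `x` into the Bohr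
  -- set.
  refine ⟨Set.range (Set.rangeSplitting c), Set.finite_range _, fun x => ?_⟩
  refine ⟨_, ⟨⟨c x⁻¹, x⁻¹, rfl⟩, rfl⟩, ?_⟩
  simpa using hc x⁻¹ _ (Set.apply_rangeSplitting c ⟨c x⁻¹, x⁻¹, rfl⟩).symm

theorem isThick_bohrSet [H.FiniteIndex]
    (hθ : ∀ a ∈ H, ∀ b ∈ H, θ (a * b) = θ a + θ b) (hε : 0 < ε) :
    IsThick (bohrSet H θ ε) := by
  obtain ⟨X, _, c, hc⟩ := exists_finite_colouring_bohrSet hθ hε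
  have := Fintype.ofFinite X
  refine ⟨Fintype.card X + 1, inv_mem_bohrSet hθ, fun g => ?_⟩
  obtain ⟨i, j, hij, h⟩ := Fintype.exists_ne_map_eq_of_card_lt (fun i => c (g i)) (by simp)
  rcases lt_or_gt_of_ne hij with hlt | hlt
  · exact ⟨i, j, hlt, hc _ _ h⟩
  · exact ⟨j, i, hlt, hc _ _ h.symm⟩

/-- Some `a ^ n` with `n > 0` lies in `K`, and so do its iterated squares. If these all lay in the
Bohr set, `θ (a ^ n)` would vanish. -/
theorem not_subset_bohrSet (hθ : ∀ a ∈ H, ∀ b ∈ H, θ (a * b) = θ a + θ b) {a : G} (ha : a ∈ H)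
    (hinf : ∀ n : ℕ, n ≠ 0 → n • θ a ≠ 0) (K : Subgroup G) [K.FiniteIndex] :
    ¬ (K : Set G) ⊆ bohrSet H θ (1 / 4) := by
  intro hK
  obtain ⟨n, hn, -, hmem⟩ := K.exists_pow_mem_of_index_ne_zero Subgroup.FiniteIndex.index_ne_zero a
  refine hinf n hn.ne' (eq_zero_of_forall_norm_two_pow_nsmul_lt fun k => ?_)
  rw [← map_pow_of_map_mul hθ ha, ← map_pow_of_map_mul hθ (H.pow_mem ha n)]
  exact (hK (K.pow_mem hmem (2 ^ k))).2

end BohrSet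

/-! ### Small Bohr sets defined by squaring -/

section Halving

variable {M : Type w} [Group M]

/-- The elements `g` with `g, g ^ 2, g ^ 4, …, g ^ (2 ^ k)` in `P`. -/
def iteratedHalf (P : Set M) : ℕ → Set M
  | 0 => P
  | k + 1 => P ∩ {g | g * g ∈ iteratedHalf P k}

theorem iteratedHalf_subset (P : Set M) : ∀ k, iteratedHalf P k ⊆ P
  | 0 => subset_rfl
  | _ + 1 => Set.inter_subset_left

theorem iteratedHalf_bohrSet {H : Subgroup M} {θ : M → UnitAddCircle}
    (hθ : ∀ a ∈ H, ∀ b ∈ H, θ (a * b) = θ a + θ b) (k : ℕ) :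
    iteratedHalf (bohrSet H θ (1 / 4)) k = bohrSet H θ (1 / 4 / 2 ^ k) := by
  induction k with
  | zero => simp [iteratedHalf]
  | succ k ih =>
    ext g
    rw [iteratedHalf, ih]
    have hpow : (1 / 4 / 2 ^ (k + 1) : ℝ) = 1 / 4 / 2 ^ k / 2 := by rw [pow_succ, div_div _ _ 2]
    constructor
    · rintro ⟨⟨h1, h2⟩, -, h3⟩
      refine ⟨h1, ?_⟩
      rw [hθ g h1 g h1, norm_add_self_of_norm_lt h2] at h3
      rw [hpow]
      linarith
    · rintro ⟨h1, h2⟩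
      rw [hpow] at h2
      have h4 : (1 / 4 / 2 ^ k : ℝ) ≤ 1 / 4 :=
        div_le_self (by norm_num) (one_le_pow₀ one_le_two)
      refine ⟨⟨h1, by linarith [norm_nonneg (θ g)]⟩, H.mul_mem h1 h1, ?_⟩
      rw [hθ g h1 g h1]
      linarith [norm_add_le (θ g) (θ g)]

end Halving

/-! ### Transfer to the elementary extension -/

section Transfer

instance : Countable groupPred.Symbols := by
  have h1 : Function.Injective fun s : groupPred.Symbols => s.isLeft := by
    rintro (⟨_, ⟨⟩⟩ | ⟨_, ⟨⟩⟩) (⟨_, ⟨⟩⟩ | ⟨_, ⟨⟩⟩) h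
    · rfl
    · cases h
    · cases h
    · rfl
  exact h1.countable

/-- The symbol for the group operation. -/
def mulSymbol : groupPred.Functions 2 := GroupPredFunc.mul

/-- The symbol for the unary predicate. -/
def predSymbol : groupPred.Relations 1 := GroupPredRel.pred

/-- The term `s * t`. -/
def mulTerm {α : Type*} (s t : groupPred.Term α) : groupPred.Term α :=
  mulSymbol.apply₂ s t

/-- The formula saying that `t` lies in `iteratedHalf P k`. -/
def iteratedHalfFormula {α : Type*} : ℕ → groupPred.Term α → groupPred.Formula α
  | 0, t => predSymbol.formula₁ t
  | k + 1, t => predSymbol.formula₁ t ⊓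
      iteratedHalfFormula k (mulTerm t t)

/-- The interpretation of the unary predicate. -/
def predSet (M : Type*) [groupPred.Structure M] : Set M :=
  {x | Structure.RelMap predSymbol ![x]}

theorem mem_predSet_iff {G : Type u} {M : Type w} [groupPred.Structure G] [groupPred.Structure M]
    (f : G ↪ₑ[groupPred] M) {g : G} : f g ∈ predSet M ↔ g ∈ predSet G := by
  have h := f.map_rel predSymbol ![g]
  have h' : f ∘ ![g] = ![f g] := by
    ext i
    fin_cases i
    rfl
  rwa [h'] at h

/-- The binary function symbol is interpreted by the group operation. -/
def InterpretsMul (M : Type*) [groupPred.Structure M] [Group M] : Prop :=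
  ∀ a b : M, Structure.funMap mulSymbol ![a, b] = a * b

variable {G : Type u} [Group G] [groupPred.Structure G] {M : Type w} [Group M]
  [groupPred.Structure M]

theorem InterpretsMul.realize_mulTerm (hM : InterpretsMul M) {α : Type*} (s t : groupPred.Term α)
    (v : α → M) : (mulTerm s t).realize v = s.realize v * t.realize v := by
  rw [mulTerm, Term.realize_functions_apply₂, hM]

theorem InterpretsMul.realize_iteratedHalfFormula (hM : InterpretsMul M) {α : Type*} (k : ℕ)
    (t : groupPred.Term α) (v : α → M) :
    (iteratedHalfFormula k t).Realize v ↔ t.realize v ∈ iteratedHalf (predSet M) k := by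
  induction k generalizing t with
  | zero => exact Formula.realize_rel₁
  | succ k ih =>
    rw [iteratedHalfFormula, Formula.realize_inf, ih, hM.realize_mulTerm, Formula.realize_rel₁]
    rfl

theorem InterpretsMul.definableFun_mul (hM : InterpretsMul M) :
    (∅ : Set M).DefinableFun groupPred fun v : Fin 2 → M => v 0 * v 1 := by
  have h := (mulTerm (Term.var 0) (Term.var 1) :
    groupPred.Term (Fin 2)).definableFun_realize (M := M)
  simpa only [funext (hM.realize_mulTerm _ _), Term.realize_var] using h

theorem InterpretsMul.definable₁_iteratedHalf (hM : InterpretsMul M) (k : ℕ) :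
    (∅ : Set M).Definable₁ groupPred (iteratedHalf (predSet M) k) :=
  Set.empty_definable_iff.2 ⟨iteratedHalfFormula k (Term.var 0), by
    ext v
    exact (hM.realize_iteratedHalfFormula k (Term.var 0) v).symm⟩

/-- An elementary embedding as a group homomorphism. -/
def elementaryHom (hG : InterpretsMul G) (hM : InterpretsMul M) (f : G ↪ₑ[groupPred] M) :
    G →* M :=
  MonoidHom.mk' f fun a b => by
    rw [← hG, f.map_fun, ← hM]
    congr 1
    ext i
    fin_cases i <;> rfl

theorem FinitelyCovers.transfer (hG : InterpretsMul G) (hM : InterpretsMul M)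
    (f : G ↪ₑ[groupPred] M) {k : ℕ} (h : FinitelyCovers (iteratedHalf (predSet G) k)) :
    FinitelyCovers (iteratedHalf (predSet M) k) := by
  obtain ⟨F, hF, hcov⟩ := h
  have := hF.to_subtype
  let φ : groupPred.Formula F := Formula.iAlls (Fin 1) (Formula.iSup fun a : F =>
    iteratedHalfFormula k (mulTerm (Term.var (Sum.inr 0)) (Term.var (Sum.inl a))))
  have h1 : φ.Realize (fun a : F => (a : G)) := by
    simp only [φ, Formula.realize_iAlls, Formula.realize_iSup, hG.realize_iteratedHalfFormula,
      hG.realize_mulTerm]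
    intro x
    obtain ⟨a, ha, h⟩ := hcov (x 0)
    exact ⟨⟨a, ha⟩, h⟩
  rw [← f.map_formula] at h1
  simp only [φ, Formula.realize_iAlls, Formula.realize_iSup, hM.realize_iteratedHalfFormula,
    hM.realize_mulTerm] at h1
  refine ⟨f '' F, hF.image f, fun x => ?_⟩
  obtain ⟨a, ha⟩ := h1 fun _ => x
  exact ⟨f a, ⟨a, a.2, rfl⟩, ha⟩

theorem Refines.transfer (hG : InterpretsMul G) (hM : InterpretsMul M)
    (f : G ↪ₑ[groupPred] M) {j k : ℕ}
    (h : Refines (iteratedHalf (predSet G) j) (iteratedHalf (predSet G) k)) :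
    Refines (iteratedHalf (predSet M) j) (iteratedHalf (predSet M) k) := by
  let φ : groupPred.Formula (Fin 0) := Formula.iAlls (Fin 2)
    ((iteratedHalfFormula j (Term.var (Sum.inr 0))).imp
      ((iteratedHalfFormula j (mulTerm (Term.var (Sum.inr 1)) (Term.var (Sum.inr 0)))).imp
        (iteratedHalfFormula k (Term.var (Sum.inr 1)))))
  have h1 : φ.Realize (default : Fin 0 → G) := by
    simp only [φ, Formula.realize_iAlls, Formula.realize_imp, hG.realize_iteratedHalfFormula,
      hG.realize_mulTerm]
    exact fun x => h (x 0) (x 1)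
  rw [← f.map_formula] at h1
  simp only [φ, Formula.realize_iAlls, Formula.realize_imp, hM.realize_iteratedHalfFormula,
    hM.realize_mulTerm] at h1
  exact fun y z => h1 ![y, z]

theorem exists_isTypeConnectedComponent_lt (hG : InterpretsMul G) (hM : InterpretsMul M)
    (f : G ↪ₑ[groupPred] M) (hcov : ∀ k, FinitelyCovers (iteratedHalf (predSet G) k))
    (href : ∀ k, Refines (iteratedHalf (predSet G) (k + 1)) (iteratedHalf (predSet G) k))
    (hnot : ∀ K : Subgroup G, K.FiniteIndex → ¬ (K : Set G) ⊆ predSet G)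
    {κ : Cardinal.{w}} (hκ : (2 : Cardinal.{w}) ^ (ℵ₀ : Cardinal.{w}) < κ)
    (hsat : IsSaturated groupPred M κ) :
    ∃ N : Subgroup M, IsTypeConnectedComponent groupPred κ ∅ N ∧
      N < connectedComponent groupPred (∅ : Set M) := by
  have hκ' : ℵ₀ < κ := (cantor _).trans hκ
  obtain ⟨N, hN⟩ := exists_isTypeConnectedComponent hsat hκ hM.definableFun_mul
  refine ⟨N, hN, lt_of_le_not_ge (hN.le_connectedComponent hκ') fun hle => ?_⟩
  have hcov' : ∀ k, FinitelyCovers (iteratedHalf (predSet M) k) := fun k =>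
    (hcov k).transfer hG hM f
  have href' : ∀ k, Refines (iteratedHalf (predSet M) (k + 1)) (iteratedHalf (predSet M) k) :=
    fun k => (href k).transfer hG hM f
  -- Covering gives some `a` at level `k + 1`, and refinement with `z = 1` puts `1` at level `k`;
  -- closure under `x * y⁻¹` loses one level in the same way, harmless in the intersection.
  let T : Subgroup M := Subgroup.ofDiv (⋂₀ Set.range (iteratedHalf (predSet M)))
    ⟨1, by
      rintro _ ⟨k, rfl⟩
      obtain ⟨F, -, hF⟩ := hcov' (k + 1)
      obtain ⟨a, -, ha⟩ := hF 1
      exact href' k _ 1 ha (by rwa [one_mul])⟩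
    (by
      rintro x hx y hy _ ⟨k, rfl⟩
      exact href' k y _ (hy _ ⟨k + 1, rfl⟩) (by
        rw [inv_mul_cancel_right]
        exact hx _ ⟨k + 1, rfl⟩))
  have hTc : (T : Set M) = ⋂₀ Set.range (iteratedHalf (predSet M)) := rfl
  have hT : N ≤ T := by
    refine hN.2 ⟨⟨_, ?_, hTc⟩, (mk_quotient_le_of_finitelyCovers (Set.countable_range _) ?_ ?_
      hTc.ge).trans_lt hκ⟩
    · rintro _ ⟨k, rfl⟩
      exact hM.definable₁_iteratedHalf k
    · rintro _ ⟨k, rfl⟩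
      exact hcov' k
    · rintro _ ⟨k, rfl⟩
      exact ⟨_, ⟨k + 1, rfl⟩, href' k⟩
  -- Under the assumption `hle`, the connected component lies in `N ≤ T`, and level `0` of `T` is
  -- the predicate itself.
  obtain ⟨K, hK, hKP⟩ := exists_finiteIndex_subset hsat (aleph0_pos.trans hκ')
    (hM.definable₁_iteratedHalf 0) fun x hx => (hTc.le (hT (hle hx))) _ ⟨0, rfl⟩
  refine hnot (K.comap (elementaryHom hG hM f)) ⟨?_⟩ fun g hg => (mem_predSet_iff f).1 (hKP hg)
  rw [Subgroup.index_comap]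
  exact (inferInstance : (K.subgroupOf (elementaryHom hG hM f).range).FiniteIndex).index_ne_zero

end Transfer

/-! ### Maps to the circle and virtually solvable groups -/

section Algebra

/-- By the structure theorem, `A` would be finite if it had no free factor; otherwise project to
one. -/
theorem exists_surjective_hom_int_of_infinite {A : Type u} [CommGroup A] [Group.FG A] [Infinite A] :
    ∃ φ : A →* Multiplicative ℤ, Function.Surjective φ := by
  obtain ⟨ι, j, _, _, p, hp, e, ⟨E⟩⟩ := CommGroup.equiv_free_prod_prod_multiplicative_zmod A
  rcases isEmpty_or_nonempty j with hj | ⟨⟨i⟩⟩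
  · have : ∀ i, NeZero (p i ^ e i) := fun i => ⟨pow_ne_zero _ (hp i).ne_zero⟩
    have : ∀ i, Finite (Multiplicative (ZMod (p i ^ e i))) := fun i =>
      inferInstanceAs (Finite (ZMod (p i ^ e i)))
    exact (not_finite_iff_infinite.2 ‹Infinite A› (Finite.of_equiv _ E.symm.toEquiv)).elim
  · refine ⟨(Pi.evalMonoidHom _ i).comp ((MonoidHom.fst _ _).comp E.toMonoidHom), ?_⟩
    exact (Function.surjective_eval i).comp (Prod.fst_surjective.comp E.surjective)

theorem exists_map_unitAddCircle {G : Type u} [Group G] [Group.FG G] (H : Subgroup G)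
    [H.FiniteIndex] [Infinite (Abelianization H)] :
    ∃ θ : G → UnitAddCircle, (∀ a ∈ H, ∀ b ∈ H, θ (a * b) = θ a + θ b) ∧
      ∃ a ∈ H, ∀ n : ℕ, n ≠ 0 → n • θ a ≠ 0 := by
  classical
  have : Group.FG (Abelianization H) := Group.fg_of_surjective (QuotientGroup.mk'_surjective _)
  obtain ⟨φ, hφ⟩ := exists_surjective_hom_int_of_infinite (A := Abelianization H)
  obtain ⟨x, hx⟩ := exists_unitAddCircle_nsmul_ne_zero
  let ψ : H → ℤ := fun h => (φ (Abelianization.of h)).toAdd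
  -- The value `0` off `H` is arbitrary, as Bohr sets test `θ` only on `H`.
  refine ⟨fun g => if h : g ∈ H then ψ ⟨g, h⟩ • x else 0, fun a ha b hb => ?_, ?_⟩
  · have hm : ψ ⟨a * b, H.mul_mem ha hb⟩ = ψ ⟨a, ha⟩ + ψ ⟨b, hb⟩ := by
      have : (⟨a * b, H.mul_mem ha hb⟩ : H) = ⟨a, ha⟩ * ⟨b, hb⟩ := rfl
      simp only [ψ, this, map_mul, toAdd_mul]
    simp only [ha, hb, H.mul_mem ha hb, dif_pos, hm, add_zsmul]
  · obtain ⟨y, hy⟩ := hφ (Multiplicative.ofAdd 1)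
    obtain ⟨a, rfl⟩ := QuotientGroup.mk'_surjective _ y
    refine ⟨a, a.2, fun n hn => ?_⟩
    have ha : ψ a = 1 := congrArg Multiplicative.toAdd hy
    simp only [a.2, dif_pos, Subtype.coe_eta, ha, one_zsmul]
    rw [← natCast_zsmul]
    exact hx n (by exact_mod_cast hn)

theorem exists_isThick_separatesComponents {G : Type u} [Group G] [Group.FG G]
    (h : HasFiniteIndexSubgroupWithInfiniteAbelianization G) :
    ∃ P : Set G, IsThick P ∧ SeparatesComponents.{u, x} P := by
  obtain ⟨H, _, _⟩ := h
  obtain ⟨θ, hθ, a, ha, hinf⟩ := exists_map_unitAddCircle H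
  refine ⟨bohrSet H θ (1 / 4), isThick_bohrSet hθ (by norm_num), ?_⟩
  let _ : groupPred.Structure G := groupPredStructure (bohrSet H θ (1 / 4))
  intro M _ _ hM ⟨f⟩ κ hκ hsat _
  have hP : predSet G = bohrSet H θ (1 / 4) := rfl
  refine exists_isTypeConnectedComponent_lt (fun _ _ => rfl) hM f (fun k => ?_) (fun k => ?_)
    (fun K _ => ?_) hκ hsat
  · rw [hP, iteratedHalf_bohrSet hθ]
    exact finitelyCovers_bohrSet hθ (by positivity)
  · rw [hP, iteratedHalf_bohrSet hθ, iteratedHalf_bohrSet hθ, pow_succ, ← div_div _ _ (2 : ℝ)]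
    exact refines_bohrSet hθ
  · exact not_subset_bohrSet hθ ha hinf K

theorem exists_infinite_abelianization_of_isSolvable (K : Type u) [Group K] [Infinite K]
    [Group.IsSolvable K] : HasFiniteIndexSubgroupWithInfiniteAbelianization K := by
  by_contra hcon
  have hfin : ∀ n, (derivedSeries K n).FiniteIndex := by
    intro n
    induction n with
    | zero => exact inferInstanceAs (⊤ : Subgroup K).FiniteIndex
    | succ n ih =>
      have hab : Finite (Abelianization (derivedSeries K n)) :=
        not_infinite_iff_finite.1 fun h => hcon ⟨_, ih, h⟩
      have hc : (commutator (derivedSeries K n)).FiniteIndex :=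
        Subgroup.finiteIndex_iff_finite_quotient.2 hab
      -- The abelianization of a derived subgroup is its quotient by the next one, so finiteness
      -- bounds the next index.
      have hmap : (commutator (derivedSeries K n)).map (derivedSeries K n).subtype =
          derivedSeries K (n + 1) := by
        rw [commutator_def, Subgroup.map_commutator, ← MonoidHom.range_eq_map,
          Subgroup.range_subtype, derivedSeries_succ]
      rw [← hmap]
      refine ⟨?_⟩
      rw [Subgroup.index_map_subtype]
      exact mul_ne_zero hc.index_ne_zero ih.index_ne_zero
  obtain ⟨n, hn⟩ := (Group.isSolvable_def K).1 inferInstance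
  have := hfin n
  rw [hn] at this
  have : Finite (K ⧸ (⊥ : Subgroup K)) := inferInstance
  exact not_finite_iff_infinite.2 ‹Infinite K›
    (Finite.of_equiv _ (QuotientGroup.quotientBot (G := K)).toEquiv)

theorem HasFiniteIndexSubgroupWithInfiniteAbelianization.of_subgroup {G : Type u} [Group G]
    {K : Subgroup G} [K.FiniteIndex] (h : HasFiniteIndexSubgroupWithInfiniteAbelianization K) :
    HasFiniteIndexSubgroupWithInfiniteAbelianization G := by
  obtain ⟨H, hH, hinf⟩ := h
  refine ⟨H.map K.subtype, ⟨?_⟩, ?_⟩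
  · rw [Subgroup.index_map_subtype]
    exact mul_ne_zero hH.index_ne_zero Subgroup.FiniteIndex.index_ne_zero
  · exact Infinite.of_injective _
      (H.equivMapOfInjective K.subtype K.subtype_injective).abelianizationCongr.injective

theorem IsVirtuallySolvable.hasFiniteIndexSubgroupWithInfiniteAbelianization {G : Type u} [Group G]
    [Infinite G] (h : IsVirtuallySolvable G) :
    HasFiniteIndexSubgroupWithInfiniteAbelianization G := by
  obtain ⟨K, hK, _⟩ := h
  have : Infinite K := by
    rw [← not_finite_iff_infinite]
    intro hfin
    exact not_finite_iff_infinite.2 ‹Infinite G›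
      (Finite.of_equiv _ (Subgroup.groupEquivQuotientProdSubgroup (s := K)).symm)
  exact (exists_infinite_abelianization_of_isSolvable K).of_subgroup

end Algebra

end GroupComponents

theorem corollary4p10 (G : Type u) [Group G] [Infinite G] [Group.FG G] :
    (GroupComponents.HasFiniteIndexSubgroupWithInfiniteAbelianization G →
      ∃ P : Set G, GroupComponents.IsThick P ∧ GroupComponents.SeparatesComponents.{u, x} P) ∧
    (GroupComponents.IsVirtuallySolvable G →
      GroupComponents.HasFiniteIndexSubgroupWithInfiniteAbelianization G ∧
      ∃ P : Set G, GroupComponents.IsThick P ∧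
        GroupComponents.SeparatesComponents.{u, x} P) :=
  ⟨GroupComponents.exists_isThick_separatesComponents, fun h =>
    ⟨h.hasFiniteIndexSubgroupWithInfiniteAbelianization,
      GroupComponents.exists_isThick_separatesComponents
        h.hasFiniteIndexSubgroupWithInfiniteAbelianization⟩⟩
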